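/- Let $I,J$ be finite sets and, for each $i\in I$ and $j\in J$, let $A_i$ and $B_j$ be finite sets. For a complex Hilbert space $\mathcal K$ let $\mathcal B(\mathcal K)$ be the algebra of bounded operators on $\mathcal K$. A state on $\mathcal B(\mathcal K)$ is a positive linear functional $\omega:\mathcal B(\mathcal K)\to\mathbb C$ with $\omega(\mathbb 1)=1$ (not necessarily normal). A POVM with outcome set $A$ is a family of positive operators $(X_\alpha)_{\alpha\in A}$ with $\sum_{\alpha\in A} X_\alpha=\mathbb 1$. Theorem. Let $\mathcal H$ be a complex Hilbert space, let $X_{i,\alpha}\in\mathcal B(\mathcal H)$ ($i\in I,\ \alpha\in A_i$) and $Y_{j,\beta}\in\mathcal B(\mathcal H)$ ($j\in J,\ \beta\in B_j$) be positive operators (in particular, for example, POVMs $(X_{i,\alpha})_{\alpha\in A_i}$, $(Y_{j,\beta})_{\beta\in B_j}$ for every $i$ and $j$) with $[X_{i,\alpha},Y_{j,\beta}]=0$ for all $i,j,\alpha,\beta$, and let $\omega$ be a state on $\mathcal B(\mathcal H)$. Let $$p(i,j\,|\,\alpha,\beta)=\omega(X_{i,\alpha}Y_{j,\beta}).$$ Then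 the following are equivalent. (i) $p$ is approximately finite dimensional: for every $\varepsilon>0$ there exist a finite-dimensional Hilbert space $\mathcal H_\varepsilon$, POVMs $(X^\varepsilon_{i,\alpha})_{\alpha\in A_i}$ ($i\in I$) and $(Y^\varepsilon_{j,\beta})_{\beta\in B_j}$ ($j\in J$) in $\mathcal B(\mathcal H_\varepsilon)$ with $[X^\varepsilon_{i,\alpha},Y^\varepsilon_{j,\beta}]=0$ for all $i,j,\alpha,\beta$, and a state $\omega_\varepsilon$ on $\mathcal B(\mathcal H_\varepsilon)$, such that $|p(i,j\,|\,\alpha,\beta)-\omega_\varepsilon(X^\varepsilon_{i,\alpha}Y^\varepsilon_{j,\beta})|<\varepsilon$ for all $i,j,\alpha,\beta$. (ii) There exist Hilbert spaces $\mathcal H_A,\mathcal H_B$, POVMs $(\tilde X_{i,\alpha})_{\alpha\in A_i}$ ($i\in I$) in $\mathcal B(\mathcal H_A)$ and $(\tilde Y_{j,\beta})_{\beta\in B_j}$ ($j\in J$) in $\mathcal B(\mathcal H_B)$, and a state $\tilde\omega$ on $\mathcal B(\mathcal H_A\otimes\mathcal H_B)$, where $\mathcal H_A\otimes\mathcal H_B$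 is the Hilbert space tensor product, such that $p(i,j\,|\,\alpha,\beta)=\tilde\omega(\tilde X_{i,\alpha}\otimes\tilde Y_{j,\beta})$ for all $i,j,\alpha,\beta$. -/

import Mathlib

open scoped TensorProduct ComplexOrder InnerProductSpace

/-- The Hilbert space tensor product: the completion of the algebraic tensor product with respect
to the inner product `⟪x ⊗ y, x' ⊗ y'⟫ = ⟪x, x'⟫ * ⟪y, y'⟫`. -/
abbrev HilbertTensor (HA HB : Type*) [NormedAddCommGroup HA] [InnerProductSpace ℂ HA]
    [NormedAddCommGroup HB] [InnerProductSpace ℂ HB] : Type _ :=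
  UniformSpace.Completion (HA ⊗[ℂ] HB)

/-- The bounded operator `S ⊗ T` on the Hilbert space tensor product: the continuous extension of
the algebraic tensor product of `S` and `T`. -/
noncomputable def opTensor {HA HB : Type*} [NormedAddCommGroup HA] [InnerProductSpace ℂ HA]
    [NormedAddCommGroup HB] [InnerProductSpace ℂ HB] (S : HA →L[ℂ] HA) (T : HB →L[ℂ] HB) :
    HilbertTensor HA HB →L[ℂ] HilbertTensor HA HB :=
  (TensorProduct.mapL S T).completion

/-- A state on `B(H)`: a positive linear functional with value one at the identity.
It is not required to be normal. -/
def IsState {H : Type*} [NormedAddCommGroup H] [InnerProductSpace ℂ H]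
    (ω : (H →L[ℂ] H) →ₚ[ℂ] ℂ) : Prop :=
  ω 1 = 1

/-- `X i α` is, for every measurement device `i`, a POVM with finite outcome set `A i`:
positive operators that sum up to the identity. -/
structure IsPOVMFamily {I : Type*} {A : I → Type*} [∀ i, Fintype (A i)]
    {H : Type*} [NormedAddCommGroup H] [InnerProductSpace ℂ H]
    (X : ∀ i, A i → (H →L[ℂ] H)) : Prop where
  isPositive : ∀ i α, (X i α).IsPositive
  sum_eq_one : ∀ i, ∑ α, X i α = 1

universe uI uJ uA uB uH v w

/-- `p` can be approximated with arbitrary precision by correlation functions of commuting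
POVMs and states on finite-dimensional Hilbert spaces. -/
def IsApproxFiniteDimensional {I : Type uI} {J : Type uJ} {A : I → Type uA} {B : J → Type uB}
    [∀ i, Fintype (A i)] [∀ j, Fintype (B j)] (p : ∀ i j, A i → B j → ℝ) : Prop :=
  ∀ ε : ℝ, 0 < ε →
    ∃ (K : Type v) (_ : NormedAddCommGroup K) (_ : InnerProductSpace ℂ K)
      (_ : FiniteDimensional ℂ K)
      (X : ∀ i, A i → (K →L[ℂ] K)) (Y : ∀ j, B j → (K →L[ℂ] K)) (ω : (K →L[ℂ] K) →ₚ[ℂ] ℂ),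
      IsPOVMFamily X ∧ IsPOVMFamily Y ∧ (∀ i j α β, Commute (X i α) (Y j β)) ∧ IsState ω ∧
      ∀ i j α β, ‖(p i j α β : ℂ) - ω (X i α * Y j β)‖ < ε

/-- `p` is exactly the correlation function of POVMs on two Hilbert spaces `HA`, `HB` and a state
on the bounded operators on the Hilbert space tensor product of `HA` and `HB`. -/
def IsTensorRealizable {I : Type uI} {J : Type uJ} {A : I → Type uA} {B : J → Type uB}
    [∀ i, Fintype (A i)] [∀ j, Fintype (B j)] (p : ∀ i j, A i → B j → ℝ) : Prop :=
  ∃ (HA : Type v) (_ : NormedAddCommGroup HA) (_ : InnerProductSpace ℂ HA) (_ : CompleteSpace HA)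
    (HB : Type v) (_ : NormedAddCommGroup HB) (_ : InnerProductSpace ℂ HB) (_ : CompleteSpace HB)
    (X : ∀ i, A i → (HA →L[ℂ] HA)) (Y : ∀ j, B j → (HB →L[ℂ] HB))
    (ω : (HilbertTensor HA HB →L[ℂ] HilbertTensor HA HB) →ₚ[ℂ] ℂ),
    IsPOVMFamily X ∧ IsPOVMFamily Y ∧ IsState ω ∧
    ∀ i j α β, (p i j α β : ℂ) = ω (opTensor (X i α) (Y j β))

/-! From finite-dimensional approximations to a tensor model: place the approximations with errors
`1 / (n + 1)` block-diagonally on the Hilbert sum of their spaces, and use this sum on both sides.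
By Riesz extension (`exists_state_of_nonneg_on_span`), a state with values `p` exists once `∑ c S ⊗
T ≥ 0` forces `∑ c p ≥ 0`. Restricting to the block `G n ⊗ G n` gives `∑ c S' ⊗ T' ≥ 0`.
Multiplication of commuting matrix algebras is a representation of their algebraic tensor product,
and the representation on `G n ⊗ G n` is faithful, so the spectrum can only shrink and `∑ c S' T' ≥
0` (`LinearMap.IsPositive.of_algHom`). Apply the `n`-th state and let `n` tend to infinity.

Conversely, by Hahn–Banach, mixtures of vector states with vectors in the algebraic tensor product
approximate any state, normal or not, on finitely many self-adjoint operators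
(`IsState.mem_closure_convexHull`). The finitely many vectors lie in some finite-dimensional `G ⊗
G'`, and compressing the POVMs to `G` and `G'` leaves the relevant expectations unchanged. -/

/-! ### Extension of functionals to states -/

/-- A real functional on the self-adjoint part of an ordered star algebra that is nonnegative on
nonnegative elements extends to a positive complex functional. -/
theorem PositiveLinearMap.exists_extend_selfAdjoint {A : Type*} [NonUnitalRing A] [StarRing A]
    [Module ℂ A] [StarModule ℂ A] [PartialOrder A] [StarOrderedRing A]
    (g : selfAdjoint A →ₗ[ℝ] ℝ) (hg : ∀ x : selfAdjoint A, 0 ≤ (x : A) → 0 ≤ g x) :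
    ∃ ω : A →ₚ[ℂ] ℂ, ∀ x : selfAdjoint A, ω x = g x := by
  let ωₗ : A →ₗ[ℂ] ℂ := Module.Dual.extendRCLike (g ∘ₗ realPart)
  have hω (x : selfAdjoint A) : ωₗ x = g x := by
    have h₁ : realPart (x : A) = x := by ext1; exact x.2.coe_realPart
    have h₂ : realPart (Complex.I • (x : A)) = 0 := by
      rw [realPart_I_smul, x.2.imaginaryPart, neg_zero]
    have := Module.Dual.extendRCLike_apply (𝕜 := ℂ) (g ∘ₗ realPart) (x : A)
    refine this.trans ?_
    simp only [LinearMap.comp_apply, RCLike.I_to_complex, h₁, h₂]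
    simp
  refine ⟨PositiveLinearMap.mk₀ ωₗ fun x hx => ?_, hω⟩
  rw [show ωₗ x = _ from hω ⟨x, IsSelfAdjoint.of_nonneg hx⟩]
  exact_mod_cast hg _ hx

/-- A functional that is positive on the real span of finitely many self-adjoint operators, one of
which is the identity, is the restriction of a state. -/
theorem exists_state_of_nonneg_on_span {H : Type*} [NormedAddCommGroup H] [InnerProductSpace ℂ H]
    [CompleteSpace H] {κ : Type*} [Fintype κ] (T : κ → (H →L[ℂ] H)) (p : κ → ℝ) (k₀ : κ)
    (hT : ∀ k, IsSelfAdjoint (T k)) (hT₀ : T k₀ = 1) (hp₀ : p k₀ = 1)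
    (h : ∀ c : κ → ℝ, 0 ≤ ∑ k, c k • T k → 0 ≤ ∑ k, c k * p k) :
    ∃ ω : (H →L[ℂ] H) →ₚ[ℂ] ℂ, IsState ω ∧ ∀ k, ω (T k) = p k := by
  classical
  let T' : κ → selfAdjoint (H →L[ℂ] H) := fun k => ⟨T k, hT k⟩
  let L := Fintype.linearCombination ℝ T'
  let φ := Fintype.linearCombination ℝ p
  have hL (c : κ → ℝ) : (L c : H →L[ℂ] H) = ∑ k, c k • T k := by
    simp [L, T', Fintype.linearCombination_apply]
  have hφ (c : κ → ℝ) : φ c = ∑ k, c k * p k := by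
    simp [φ, Fintype.linearCombination_apply]
  -- Positivity for both `c` and `-c` makes the functional well defined on the span.
  have hker : LinearMap.ker L ≤ LinearMap.ker φ := by
    intro c hc
    have hc' : ∑ k, c k • T k = 0 := by rw [← hL, LinearMap.mem_ker.1 hc]; rfl
    have h₁ := h c hc'.ge
    have h₂ := h (-c) (by simp [hc'])
    simp only [Pi.neg_apply, neg_mul, Finset.sum_neg_distrib] at h₂
    rw [LinearMap.mem_ker, hφ]
    linarith
  let f : selfAdjoint (H →L[ℂ] H) →ₗ.[ℝ] ℝ :=
    ⟨LinearMap.range L, (Submodule.liftQ _ φ hker) ∘ₗ (L.quotKerEquivRange.symm : _ →ₗ[ℝ] _)⟩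
  have hf (c : κ → ℝ) : f ⟨L c, LinearMap.mem_range_self L c⟩ = φ c := by
    have : L.quotKerEquivRange.symm ⟨L c, LinearMap.mem_range_self L c⟩ =
        (LinearMap.ker L).mkQ c := by
      rw [LinearEquiv.symm_apply_eq]
      rfl
    change Submodule.liftQ _ φ hker (L.quotKerEquivRange.symm ⟨L c, _⟩) = _
    rw [this]
    simp
  let s : PointedCone ℝ (selfAdjoint (H →L[ℂ] H)) :=
    { carrier := {x | 0 ≤ (x : H →L[ℂ] H)}
      zero_mem' := by simp
      add_mem' := fun {a b} ha hb => by
        have : 0 ≤ (a : H →L[ℂ] H) + b := add_nonneg ha hb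
        simpa using this
      smul_mem' := fun c x hx => by
        have : 0 ≤ (c : ℝ) • (x : H →L[ℂ] H) := smul_nonneg c.2 hx
        exact this }
  have hs (x) : x ∈ s ↔ 0 ≤ (x : H →L[ℂ] H) := Iff.rfl
  have hsingle (k : κ) (r : ℝ) : (L (Pi.single k r) : H →L[ℂ] H) = r • T k := by
    rw [hL, Finset.sum_eq_single k] <;> simp +contextual
  obtain ⟨g, hgf, hgs⟩ := riesz_extension s f
    (by
      rintro ⟨_, c, rfl⟩ hx
      rw [hs] at hx
      rw [hf, hφ]
      exact h c (by rwa [← hL]))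
    (by
      intro y
      -- The identity is an order unit: `‖y‖ • 1 + y ≥ 0`, which is the domination condition of
      -- Riesz extension.
      refine ⟨⟨L (Pi.single k₀ ‖(y : H →L[ℂ] H)‖), LinearMap.mem_range_self _ _⟩, ?_⟩
      have h₁ := sub_nonneg.2 y.2.neg_algebraMap_norm_le_self
      rw [Algebra.algebraMap_eq_smul_one, sub_neg_eq_add, add_comm, ← hT₀, ← hsingle] at h₁
      exact h₁)
  obtain ⟨ω, hω⟩ := PositiveLinearMap.exists_extend_selfAdjoint g hgs
  have hgT (k : κ) : g (T' k) = p k := by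
    have : L (Pi.single k 1) = T' k :=
      Subtype.ext ((hsingle k 1).trans (one_smul ℝ _))
    have h2 := hgf ⟨L (Pi.single k 1), LinearMap.mem_range_self _ _⟩
    rw [hf] at h2
    rw [← this, h2]
    simp [φ]
  have hωT (k : κ) : ω (T k) = p k := by rw [← hgT]; exact hω (T' k)
  refine ⟨ω, ?_, hωT⟩
  have := hωT k₀
  rw [hT₀, hp₀] at this
  simpa [IsState] using this

/-! ### Positivity of tensor products versus products of commuting matrices -/

theorem LinearMap.IsSymmetric.isPositive_of_hasEigenvalue {K : Type*} [NormedAddCommGroup K]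
    [InnerProductSpace ℂ K] [FiniteDimensional ℂ K] {T : K →ₗ[ℂ] K} (hT : T.IsSymmetric)
    (h : ∀ μ : ℝ, Module.End.HasEigenvalue T (μ : ℂ) → 0 ≤ μ) : T.IsPositive := by
  refine ⟨hT, fun x => ?_⟩
  have hx : ⟪T x, x⟫_ℂ = ∑ i, ⟪T x, hT.eigenvectorBasis rfl i⟫_ℂ *
      ⟪hT.eigenvectorBasis rfl i, x⟫_ℂ :=
    ((hT.eigenvectorBasis rfl).sum_inner_mul_inner _ _).symm
  rw [hx, map_sum]
  refine Finset.sum_nonneg fun i _ => ?_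
  rw [hT, hT.apply_eigenvectorBasis, inner_smul_right, mul_assoc, RCLike.re_ofReal_mul,
    inner_mul_symm_re_eq_norm]
  exact mul_nonneg (h _ (hT.hasEigenvalue_eigenvalues rfl i)) (norm_nonneg _)

/-- If a representation `i` is faithful, positivity of `i t` implies positivity of `μ t` for every
other representation `μ` in which `t` is symmetric. -/
theorem LinearMap.IsPositive.of_algHom {K L : Type*} [NormedAddCommGroup K]
    [InnerProductSpace ℂ K] [FiniteDimensional ℂ K] [NormedAddCommGroup L]
    [InnerProductSpace ℂ L] [FiniteDimensional ℂ L] {D : Type*} [Ring D] [Algebra ℂ D]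
    {i : D →ₐ[ℂ] Module.End ℂ L} (hi : Function.Injective i) (μ : D →ₐ[ℂ] Module.End ℂ K) {t : D}
    (ht : (i t).IsPositive) (hμ : (μ t).IsSymmetric) : (μ t).IsPositive := by
  refine hμ.isPositive_of_hasEigenvalue fun r hr => ?_
  -- Faithfulness gives `i t` the minimal polynomial of `t`, which annihilates `μ t`; hence every
  -- eigenvalue of `μ t` is one of `i t`.
  have hroot : (minpoly ℂ (i t)).IsRoot r := by
    rw [minpoly.algHom_eq i hi]
    refine (Module.End.hasEigenvalue_iff_isRoot.1 hr).dvd (minpoly.dvd _ _ ?_)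
    rw [Polynomial.aeval_algHom_apply, minpoly.aeval, map_zero]
  obtain ⟨v, hv⟩ := (Module.End.hasEigenvalue_iff_isRoot.2 hroot).exists_hasEigenvector
  have h₁ := ht.re_inner_nonneg_right v
  have h₂ : 0 < RCLike.re ⟪v, v⟫_ℂ := by
    rw [inner_self_eq_norm_sq]
    have := norm_pos_iff.2 hv.2
    positivity
  rw [hv.apply_eq_smul, inner_smul_right] at h₁
  exact nonneg_of_mul_nonneg_left ((RCLike.re_ofReal_mul r ⟪v, v⟫_ℂ).symm ▸ h₁) h₂

/-- Over a field, tensoring two inclusions stays injective, and in finite dimension `End K ⊗ End K`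
is all of `End (K ⊗ K)`. -/
theorem Module.endTensorEndAlgHom_comp_map_val_injective {K : Type*} [AddCommGroup K] [Module ℂ K]
    [FiniteDimensional ℂ K] (𝒜 ℬ : Subalgebra ℂ (Module.End ℂ K)) :
    Function.Injective ((Module.endTensorEndAlgHom : _ →ₐ[ℂ] Module.End ℂ (K ⊗[ℂ] K)).comp
      (Algebra.TensorProduct.map 𝒜.val ℬ.val)) := by
  have h₁ : Function.Injective (Algebra.TensorProduct.map 𝒜.val ℬ.val) :=
    TensorProduct.map_injective_of_flat_flat _ _ Subtype.val_injective Subtype.val_injective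
  have h₂ : Function.Injective (Module.endTensorEndAlgHom :
      Module.End ℂ K ⊗[ℂ] Module.End ℂ K →ₐ[ℂ] Module.End ℂ (K ⊗[ℂ] K)) := by
    intro x y hxy
    apply (homTensorHomEquiv ℂ K K K K).injective
    rw [homTensorHomEquiv_apply, homTensorHomEquiv_apply]
    exact hxy
  exact h₂.comp h₁

/-- Both operators represent the same element `∑ c S ⊗ T` of `𝒜 ⊗ ℬ`: one on `K ⊗ K`, faithfully,
the other on `K` by multiplication. -/
theorem Subalgebra.isPositive_sum_smul_mul_of_isPositive_sum_smul_map {K : Type*}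
    [NormedAddCommGroup K] [InnerProductSpace ℂ K] [FiniteDimensional ℂ K] {κ : Type*} [Fintype κ]
    (𝒜 ℬ : Subalgebra ℂ (Module.End ℂ K)) (hAB : ∀ (a : 𝒜) (b : ℬ), Commute (𝒜.val a) (ℬ.val b))
    (S : κ → 𝒜) (T : κ → ℬ) (c : κ → ℂ)
    (hsymm : (∑ k, c k • ((S k : Module.End ℂ K) * T k)).IsSymmetric)
    (h : (∑ k, c k • TensorProduct.map (S k : Module.End ℂ K) (T k : Module.End ℂ K)).IsPositive) :
    (∑ k, c k • ((S k : Module.End ℂ K) * T k)).IsPositive := by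
  have hμt : Algebra.TensorProduct.lift 𝒜.val ℬ.val hAB (∑ k, c k • (S k ⊗ₜ[ℂ] T k)) =
      ∑ k, c k • ((S k : Module.End ℂ K) * T k) := by
    rw [map_sum]
    refine Finset.sum_congr rfl fun k _ => ?_
    rw [map_smul, Algebra.TensorProduct.lift_tmul]
    rfl
  have hit : ((Module.endTensorEndAlgHom : _ →ₐ[ℂ] Module.End ℂ (K ⊗[ℂ] K)).comp
      (Algebra.TensorProduct.map 𝒜.val ℬ.val)) (∑ k, c k • (S k ⊗ₜ[ℂ] T k)) =
      ∑ k, c k • TensorProduct.map (S k : Module.End ℂ K) (T k : Module.End ℂ K) := by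
    rw [map_sum]
    refine Finset.sum_congr rfl fun k _ => ?_
    rw [map_smul, AlgHom.comp_apply, Algebra.TensorProduct.map_tmul,
      Module.endTensorEndAlgHom_apply, TensorProduct.AlgebraTensorModule.map_eq]
    rfl
  have hpos := LinearMap.IsPositive.of_algHom
    (Module.endTensorEndAlgHom_comp_map_val_injective 𝒜 ℬ)
    (Algebra.TensorProduct.lift 𝒜.val ℬ.val hAB) (t := ∑ k, c k • (S k ⊗ₜ[ℂ] T k))
  rw [hit, hμt] at hpos
  exact hpos h hsymm

/-- For two commuting families of operators on a finite-dimensional space, positivity of a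
combination of tensor products implies positivity of the same combination of products. -/
theorem LinearMap.isPositive_sum_smul_mul_of_isPositive_sum_smul_map {K : Type*}
    [NormedAddCommGroup K] [InnerProductSpace ℂ K] [FiniteDimensional ℂ K] {κ : Type*} [Fintype κ]
    (S T : κ → Module.End ℂ K) (hS : ∀ k, (S k).IsSymmetric) (hT : ∀ k, (T k).IsSymmetric)
    (hST : ∀ k l, Commute (S k) (T l)) (c : κ → ℝ)
    (h : (∑ k, (c k : ℂ) • TensorProduct.map (S k) (T k)).IsPositive) :
    (∑ k, (c k : ℂ) • (S k * T k)).IsPositive := by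
  -- The commutant of the `T k` and its bicommutant are commuting subalgebras containing the `S k`
  -- and the `T k` respectively.
  have hS' (k : κ) : S k ∈ Subalgebra.centralizer ℂ (Set.range T) := by
    rw [Subalgebra.mem_centralizer_iff]
    rintro _ ⟨l, rfl⟩
    exact (hST k l).eq.symm
  have hT' (k : κ) : T k ∈ Subalgebra.centralizer ℂ
      (Subalgebra.centralizer ℂ (Set.range T) : Set (Module.End ℂ K)) := by
    rw [Subalgebra.mem_centralizer_iff]
    intro a ha
    exact ((Subalgebra.mem_centralizer_iff ℂ).1 ha _ ⟨k, rfl⟩).symm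
  refine Subalgebra.isPositive_sum_smul_mul_of_isPositive_sum_smul_map
    (Subalgebra.centralizer ℂ (Set.range T)) (Subalgebra.centralizer ℂ
      (Subalgebra.centralizer ℂ (Set.range T) : Set (Module.End ℂ K)))
    (fun a b => (Subalgebra.mem_centralizer_iff ℂ).1 b.2 a a.2)
    (fun k => ⟨S k, hS' k⟩) (fun k => ⟨T k, hT' k⟩) (fun k => (c k : ℂ)) ?_ h
  intro x y
  simp only [LinearMap.sum_apply, LinearMap.smul_apply, Module.End.mul_apply, sum_inner,
    inner_sum, inner_smul_left, inner_smul_right, Complex.conj_ofReal]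
  refine Finset.sum_congr rfl fun k _ => ?_
  rw [hS k, hT k]
  congr 2
  exact congr($((hST k k).eq.symm) y)

/-! ### Operators on the Hilbert tensor product and limits of correlations -/

section OpTensor

variable {HA HB : Type*} [NormedAddCommGroup HA] [InnerProductSpace ℂ HA]
  [NormedAddCommGroup HB] [InnerProductSpace ℂ HB]

theorem TensorProduct.isSymmetric_map {S : HA →ₗ[ℂ] HA} {T : HB →ₗ[ℂ] HB} (hS : S.IsSymmetric)
    (hT : T.IsSymmetric) : (TensorProduct.map S T).IsSymmetric := by
  intro x y
  induction x with
  | zero => simp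
  | add x₁ x₂ h₁ h₂ => rw [map_add, inner_add_left, inner_add_left, h₁, h₂]
  | tmul a b =>
    induction y with
    | zero => simp
    | add y₁ y₂ h₁ h₂ => rw [map_add, inner_add_right, inner_add_right, h₁, h₂]
    | tmul c d =>
      rw [TensorProduct.map_tmul, TensorProduct.map_tmul, TensorProduct.inner_tmul,
        TensorProduct.inner_tmul, hS, hT]

theorem opTensor_coe (S : HA →L[ℂ] HA) (T : HB →L[ℂ] HB) (x : HA ⊗[ℂ] HB) :
    opTensor S T (x : HilbertTensor HA HB) =
      (TensorProduct.map S.toLinearMap T.toLinearMap x : HA ⊗[ℂ] HB) := by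
  rw [opTensor, ContinuousLinearMap.completion_apply_coe, TensorProduct.mapL_apply]

theorem opTensor_one_one : opTensor (1 : HA →L[ℂ] HA) (1 : HB →L[ℂ] HB) = 1 := by
  ext x
  induction x using UniformSpace.Completion.induction_on with
  | hp => exact isClosed_eq (ContinuousLinearMap.continuous _) (ContinuousLinearMap.continuous _)
  | ih x =>
    rw [opTensor_coe]
    exact congr_arg _ (congr($(TensorProduct.map_id (R := ℂ) (M := HA) (N := HB)) x))

theorem isSelfAdjoint_opTensor {S : HA →L[ℂ] HA} {T : HB →L[ℂ] HB} (hS : S.IsSymmetric)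
    (hT : T.IsSymmetric) : IsSelfAdjoint (opTensor S T) := by
  rw [ContinuousLinearMap.isSelfAdjoint_iff_isSymmetric]
  intro x y
  induction x, y using UniformSpace.Completion.induction_on₂ with
  | hp =>
    exact isClosed_eq (by fun_prop) (by fun_prop)
  | ih x y =>
    simp only [ContinuousLinearMap.coe_coe, opTensor_coe, UniformSpace.Completion.inner_coe]
    exact TensorProduct.isSymmetric_map hS hT x y

/-- Positivity of a combination of operators `S ⊗ T` passes to reducing subspaces. -/
theorem isPositive_sum_smul_map_of_nonneg_sum_smul_opTensor {κ : Type*} [Fintype κ] {GA GB : Type*}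
    [NormedAddCommGroup GA] [InnerProductSpace ℂ GA] [NormedAddCommGroup GB]
    [InnerProductSpace ℂ GB] (u : GA →ₗᵢ[ℂ] HA) (v : GB →ₗᵢ[ℂ] HB) (S : κ → (HA →L[ℂ] HA))
    (T : κ → (HB →L[ℂ] HB)) (S' : κ → (GA →L[ℂ] GA)) (T' : κ → (GB →L[ℂ] GB))
    (hS' : ∀ k, (S' k).IsSymmetric) (hT' : ∀ k, (T' k).IsSymmetric)
    (hS : ∀ k x, S k (u x) = u (S' k x)) (hT : ∀ k x, T k (v x) = v (T' k x)) (c : κ → ℝ)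
    (h : 0 ≤ ∑ k, c k • opTensor (S k) (T k)) :
    (∑ k, (c k : ℂ) •
      TensorProduct.map (S' k : GA →ₗ[ℂ] GA) (T' k : GB →ₗ[ℂ] GB)).IsPositive := by
  constructor
  · intro x y
    simp only [LinearMap.sum_apply, LinearMap.smul_apply, sum_inner, inner_sum, inner_smul_left,
      inner_smul_right, Complex.conj_ofReal]
    exact Finset.sum_congr rfl fun k _ =>
      congr_arg _ (TensorProduct.isSymmetric_map (hS' k) (hT' k) x y)
  · intro x
    rw [ContinuousLinearMap.nonneg_iff_isPositive] at h
    have h₁ := h.re_inner_nonneg_left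
      (TensorProduct.map u.toLinearMap v.toLinearMap x : HA ⊗[ℂ] HB)
    -- `u ⊗ v` intertwines the small operators with the large ones and preserves inner products, so
    -- the quadratic forms agree.
    have h₂ (k : κ) : TensorProduct.map (S k : HA →ₗ[ℂ] HA) (T k : HB →ₗ[ℂ] HB)
        (TensorProduct.map u.toLinearMap v.toLinearMap x) =
        TensorProduct.map u.toLinearMap v.toLinearMap
          (TensorProduct.map (S' k : GA →ₗ[ℂ] GA) (T' k : GB →ₗ[ℂ] GB) x) := by
      rw [TensorProduct.map_map, TensorProduct.map_map]
      congr 2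
      · ext y; exact hS k y
      · ext y; exact hT k y
    simp only [sum_apply, smul_apply, opTensor_coe, h₂,
      sum_inner, ← Complex.coe_smul, inner_smul_left, UniformSpace.Completion.inner_coe,
      TensorProduct.inner_map_map] at h₁
    simpa only [LinearMap.sum_apply, LinearMap.smul_apply, sum_inner, inner_smul_left] using h₁

/-- A limit of finite-dimensional commuting correlations, whose operators are compressions of
operators on `HA` and `HB` to reducing subspaces, is given by a state on the Hilbert space tensor
product. -/
theorem exists_state_opTensor_of_tendsto {κ : Type*} [Fintype κ] {G : ℕ → Type*}
    [∀ n, NormedAddCommGroup (G n)] [∀ n, InnerProductSpace ℂ (G n)]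
    [∀ n, FiniteDimensional ℂ (G n)] (u : ∀ n, G n →ₗᵢ[ℂ] HA) (v : ∀ n, G n →ₗᵢ[ℂ] HB)
    (S : κ → (HA →L[ℂ] HA)) (T : κ → (HB →L[ℂ] HB)) (S' T' : ∀ n, κ → (G n →L[ℂ] G n))
    (hSsymm : ∀ k, (S k).IsSymmetric) (hTsymm : ∀ k, (T k).IsSymmetric)
    (hS' : ∀ n k, (S' n k).IsSymmetric) (hT' : ∀ n k, (T' n k).IsSymmetric)
    (hST : ∀ n k l, Commute (S' n k) (T' n l))
    (hS : ∀ n k x, S k (u n x) = u n (S' n k x)) (hT : ∀ n k x, T k (v n x) = v n (T' n k x))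
    (ω : ∀ n, (G n →L[ℂ] G n) →ₚ[ℂ] ℂ) (p : κ → ℝ)
    (hp : ∀ k, Filter.Tendsto (fun n => ω n (S' n k * T' n k)) Filter.atTop (nhds (p k : ℂ)))
    (k₀ : κ) (hS₀ : S k₀ = 1) (hT₀ : T k₀ = 1) (hp₀ : p k₀ = 1) :
    ∃ φ : (HilbertTensor HA HB →L[ℂ] HilbertTensor HA HB) →ₚ[ℂ] ℂ,
      IsState φ ∧ ∀ k, φ (opTensor (S k) (T k)) = p k := by
  refine exists_state_of_nonneg_on_span (fun k => opTensor (S k) (T k)) p k₀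
    (fun k => isSelfAdjoint_opTensor (hSsymm k) (hTsymm k))
    (by simp only [hS₀, hT₀, opTensor_one_one]) hp₀ fun c hc => ?_
  have hn (n : ℕ) : 0 ≤ ∑ k, (c k : ℂ) * ω n (S' n k * T' n k) := by
    have h₁ := LinearMap.isPositive_sum_smul_mul_of_isPositive_sum_smul_map
      (fun k => (S' n k : G n →ₗ[ℂ] G n)) (fun k => (T' n k : G n →ₗ[ℂ] G n)) (hS' n) (hT' n)
      (fun k l => congr_arg ContinuousLinearMap.toLinearMap (hST n k l).eq) c
      (isPositive_sum_smul_map_of_nonneg_sum_smul_opTensor (u n) (v n) S T (S' n) (T' n)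
        (hS' n) (hT' n) (hS n) (hT n) c hc)
    have h₂ : 0 ≤ ∑ k, (c k : ℂ) • (S' n k * T' n k) := by
      rw [ContinuousLinearMap.nonneg_iff_isPositive, ← ContinuousLinearMap.isPositive_toLinearMap_iff]
      convert h₁
      ext x
      simp
    have h₃ := (ω n).map_nonneg h₂
    simpa only [map_sum, map_smul, smul_eq_mul] using h₃
  have hlim : Filter.Tendsto (fun n => ∑ k, (c k : ℂ) * ω n (S' n k * T' n k)) Filter.atTop
      (nhds (∑ k, (c k : ℂ) * p k)) :=
    tendsto_finsetSum _ fun k _ => (hp k).const_mul _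
  have := ge_of_tendsto' hlim hn
  exact_mod_cast this

end OpTensor

/-! ### Block-diagonal operators on a Hilbert sum -/

section LpDiag

variable {G : ℕ → Type*} [∀ n, NormedAddCommGroup (G n)] [∀ n, InnerProductSpace ℂ (G n)]

/-- The diagonal operator on a Hilbert sum given by a sequence of contractions. -/
noncomputable def lpDiag (S : ∀ n, G n →L[ℂ] G n) (hS : ∀ n, ‖S n‖ ≤ 1) : lp G 2 →L[ℂ] lp G 2 :=
  have hle (f : lp G 2) (n : ℕ) : ‖S n (f n)‖ ≤ ‖f n‖ :=
    (S n).le_of_opNorm_le (hS n) _ |>.trans_eq (one_mul _)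
  LinearMap.mkContinuous
    { toFun := fun f => ⟨fun n => S n (f n), (lp.memℓp f).mono' (hle f)⟩
      map_add' := fun f g => by ext n; exact map_add (S n) _ _
      map_smul' := fun c f => by ext n; simp } 1
    fun f => by
      rw [one_mul]
      exact lp.norm_mono (by simp) (hle f)

variable {S : ∀ n, G n →L[ℂ] G n} {hS : ∀ n, ‖S n‖ ≤ 1}

theorem lpDiag_apply (f : lp G 2) (n : ℕ) : lpDiag S hS f n = S n (f n) := rfl

theorem lpDiag_single (n : ℕ) (x : G n) :
    lpDiag S hS (lp.single 2 n x) = lp.single 2 n (S n x) := by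
  ext m
  rw [lpDiag_apply]
  rcases eq_or_ne m n with rfl | h
  · simp
  · simp [h]

theorem isPositive_lpDiag (h : ∀ n, (S n).IsPositive) : (lpDiag S hS).IsPositive := by
  refine (ContinuousLinearMap.isPositive_iff _).2 ⟨fun f g => ?_, fun f => ?_⟩
  · simp only [ContinuousLinearMap.coe_coe, lp.inner_eq_tsum, lpDiag_apply]
    exact tsum_congr fun n => (h n).isSymmetric _ _
  · rw [lp.inner_eq_tsum]
    exact tsum_nonneg fun n => (h n).inner_nonneg_left (f n)

end LpDiag

/-! ### From approximations to a tensor model -/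

section Transport

variable {I : Type uI} {J : Type uJ} {A : I → Type uA} {B : J → Type uB}
  [∀ i, Fintype (A i)] [∀ j, Fintype (B j)] {p : ∀ i j, A i → B j → ℝ}

theorem IsPOVMFamily.norm_le_one {H : Type*} [NormedAddCommGroup H] [InnerProductSpace ℂ H]
    [CompleteSpace H] {X : ∀ i, A i → (H →L[ℂ] H)} (hX : IsPOVMFamily X) (i : I) (α : A i) :
    ‖X i α‖ ≤ 1 := by
  have h (β : A i) : 0 ≤ X i β := (ContinuousLinearMap.nonneg_iff_isPositive _).2 (hX.isPositive i β)
  refine (CStarAlgebra.norm_le_one_iff_of_nonneg _ (h α)).2 ?_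
  rw [← hX.sum_eq_one i]
  exact Finset.single_le_sum (f := X i) (fun β _ => h β) (Finset.mem_univ α)

theorem IsPOVMFamily.map {H K : Type*} [NormedAddCommGroup H] [InnerProductSpace ℂ H]
    [CompleteSpace H] [NormedAddCommGroup K] [InnerProductSpace ℂ K] [CompleteSpace K]
    {X : ∀ i, A i → (H →L[ℂ] H)} (hX : IsPOVMFamily X) (e : (H →L[ℂ] H) ≃⋆ₐ[ℂ] (K →L[ℂ] K)) :
    IsPOVMFamily fun i α => e (X i α) where
  isPositive i α := by
    rw [← ContinuousLinearMap.nonneg_iff_isPositive]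
    exact map_nonneg e ((ContinuousLinearMap.nonneg_iff_isPositive _).2 (hX.isPositive i α))
  sum_eq_one i := by rw [← map_sum, hX.sum_eq_one, map_one]

/-- The finite-dimensional spaces in the definition of approximate finite dimensionality may be
taken to be the standard ones, in any universe. -/
theorem IsApproxFiniteDimensional.exists_euclideanSpace
    (h : IsApproxFiniteDimensional.{uI, uJ, uA, uB, v} p) {ε : ℝ} (hε : 0 < ε) :
    ∃ (d : ℕ) (X : ∀ i, A i → (EuclideanSpace ℂ (ULift.{w} (Fin d)) →L[ℂ]
        EuclideanSpace ℂ (ULift.{w} (Fin d))))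
      (Y : ∀ j, B j → (EuclideanSpace ℂ (ULift.{w} (Fin d)) →L[ℂ]
        EuclideanSpace ℂ (ULift.{w} (Fin d))))
      (ω : (EuclideanSpace ℂ (ULift.{w} (Fin d)) →L[ℂ]
        EuclideanSpace ℂ (ULift.{w} (Fin d))) →ₚ[ℂ] ℂ),
      IsPOVMFamily X ∧ IsPOVMFamily Y ∧ (∀ i j α β, Commute (X i α) (Y j β)) ∧ IsState ω ∧
      ∀ i j α β, ‖(p i j α β : ℂ) - ω (X i α * Y j β)‖ < ε := by
  obtain ⟨K, _, _, _, X, Y, ω, hX, hY, hXY, hω, hp⟩ := h ε hε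
  have := FiniteDimensional.complete ℂ K
  let e := (((stdOrthonormalBasis ℂ K).reindex Equiv.ulift.{w}.symm).repr).conjStarAlgEquiv
  refine ⟨_, _, _, PositiveLinearMap.mk₀ (ω.toLinearMap ∘ₗ (e.symm.toAlgEquiv.toLinearMap))
    fun x hx => ω.map_nonneg (map_nonneg e.symm hx), hX.map e, hY.map e,
    fun i j α β => (hXY i j α β).map e, ?_, fun i j α β => ?_⟩
  · change ω (e.symm 1) = 1
    rw [map_one]
    exact hω
  · change ‖(p i j α β : ℂ) - ω (e.symm (e (X i α) * e (Y j β)))‖ < ε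
    rw [← map_mul, StarAlgEquiv.symm_apply_apply]
    exact hp i j α β

theorem IsApproxFiniteDimensional.lift (h : IsApproxFiniteDimensional.{uI, uJ, uA, uB, v} p) :
    IsApproxFiniteDimensional.{uI, uJ, uA, uB, w} p := by
  intro ε hε
  obtain ⟨d, X, Y, ω, h⟩ := h.exists_euclideanSpace.{uI, uJ, uA, uB, v, w} hε
  exact ⟨_, inferInstance, inferInstance, inferInstance, X, Y, ω, h⟩

theorem IsPOVMFamily.lpDiag {G : ℕ → Type*} [∀ n, NormedAddCommGroup (G n)]
    [∀ n, InnerProductSpace ℂ (G n)] {X : ∀ n, ∀ i, A i → (G n →L[ℂ] G n)}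
    (hX : ∀ n, IsPOVMFamily (X n)) (hX' : ∀ i α n, ‖X n i α‖ ≤ 1) :
    IsPOVMFamily fun i α => _root_.lpDiag (fun n => X n i α) (hX' i α) where
  isPositive i α := isPositive_lpDiag fun n => (hX n).isPositive i α
  sum_eq_one i := by
    ext f n
    have h := map_sum (lp.evalₗ (𝕜 := ℂ) G 2 n)
      (fun α => _root_.lpDiag (fun n => X n i α) (hX' i α) f) Finset.univ
    rw [sum_apply]
    refine h.trans ?_
    have := congr($((hX n).sum_eq_one i) (f n))
    rw [sum_apply] at this
    exact this

theorem IsApproxFiniteDimensional.isTensorRealizable [Finite I] [Finite J]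
    (h : IsApproxFiniteDimensional.{uI, uJ, uA, uB, v} p) :
    IsTensorRealizable.{uI, uJ, uA, uB, w} p := by
  classical
  have := Fintype.ofFinite I
  have := Fintype.ofFinite J
  choose d X Y ω hX hY hXY hω hp using fun n : ℕ =>
    h.exists_euclideanSpace.{uI, uJ, uA, uB, v, w} (Nat.one_div_pos_of_nat (α := ℝ) (n := n))
  let G : ℕ → Type w := fun n => EuclideanSpace ℂ (ULift.{w} (Fin (d n)))
  let X' : ∀ i, A i → (lp G 2 →L[ℂ] lp G 2) := fun i α =>
    lpDiag (fun n => X n i α) fun n => (hX n).norm_le_one i α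
  let Y' : ∀ j, B j → (lp G 2 →L[ℂ] lp G 2) := fun j β =>
    lpDiag (fun n => Y n j β) fun n => (hY n).norm_le_one j β
  have hX' : IsPOVMFamily X' := IsPOVMFamily.lpDiag hX _
  have hY' : IsPOVMFamily Y' := IsPOVMFamily.lpDiag hY _
  let u : ∀ n, G n →ₗᵢ[ℂ] lp G 2 := fun n =>
    ⟨lp.lsingle 2 n, fun x => lp.norm_single (by simp) n x⟩
  obtain ⟨φ, hφ, hφp⟩ := exists_state_opTensor_of_tendsto
    -- The extra index `none` carries the identity, which normalizes the state.
    (κ := Option ((Σ i, A i) × (Σ j, B j))) u u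
    (fun k => k.elim 1 fun k => X' k.1.1 k.1.2) (fun k => k.elim 1 fun k => Y' k.2.1 k.2.2)
    (fun n k => k.elim 1 fun k => X n k.1.1 k.1.2) (fun n k => k.elim 1 fun k => Y n k.2.1 k.2.2)
    (by
      rintro (_ | k)
      exacts [ContinuousLinearMap.isPositive_one.isSymmetric, (hX'.isPositive _ _).isSymmetric])
    (by
      rintro (_ | k)
      exacts [ContinuousLinearMap.isPositive_one.isSymmetric, (hY'.isPositive _ _).isSymmetric])
    (by
      rintro n (_ | k)
      exacts [ContinuousLinearMap.isPositive_one.isSymmetric, ((hX n).isPositive _ _).isSymmetric])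
    (by
      rintro n (_ | k)
      exacts [ContinuousLinearMap.isPositive_one.isSymmetric, ((hY n).isPositive _ _).isSymmetric])
    (by
      rintro n (_ | k) (_ | l)
      exacts [Commute.one_left _, Commute.one_left _, Commute.one_right _, hXY n _ _ _ _])
    (by
      rintro n (_ | k) x
      exacts [rfl, lpDiag_single (hS := fun n => (hX n).norm_le_one _ _) n x])
    (by
      rintro n (_ | k) x
      exacts [rfl, lpDiag_single (hS := fun n => (hY n).norm_le_one _ _) n x])
    ω (fun k => k.elim 1 fun k => p k.1.1 k.2.1 k.1.2 k.2.2)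
    (by
      rintro (_ | ⟨⟨i, α⟩, ⟨j, β⟩⟩)
      · have (n : ℕ) : ω n (1 * 1) = 1 := by rw [one_mul]; exact hω n
        simpa only [Option.elim, this, Complex.ofReal_one] using tendsto_const_nhds
      · refine tendsto_iff_norm_sub_tendsto_zero.2 (squeeze_zero (fun _ => norm_nonneg _)
          (fun n => ?_) (tendsto_one_div_add_atTop_nhds_zero_nat (𝕜 := ℝ)))
        rw [norm_sub_rev]
        exact (hp n i j α β).le)
    none rfl rfl rfl
  exact ⟨lp G 2, inferInstance, inferInstance, inferInstance, lp G 2, inferInstance,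
    inferInstance, inferInstance, X', Y', φ, hX', hY', hφ,
    fun i j α β => (hφp (some (⟨i, α⟩, ⟨j, β⟩))).symm⟩

end Transport

/-- Convex combinations of vector states supported on a dense subspace approximate every state on
finitely many self-adjoint operators. -/
theorem IsState.mem_closure_convexHull {H D : Type*} [NormedAddCommGroup H] [InnerProductSpace ℂ H]
    [CompleteSpace H] [NormedAddCommGroup D] [InnerProductSpace ℂ D] {j : D →ₗᵢ[ℂ] H}
    (hj : DenseRange j) {κ : Type*} [Fintype κ] {T : κ → (H →L[ℂ] H)}
    (hT : ∀ k, IsSelfAdjoint (T k)) {ω : (H →L[ℂ] H) →ₚ[ℂ] ℂ} (hω : IsState ω) :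
    (fun k => (ω (T k)).re) ∈ closure (convexHull ℝ
      (Set.range fun (x : {x : D // ‖x‖ = 1}) (k : κ) => (⟪T k (j x), j x⟫_ℂ).re)) := by
  classical
  -- Separate: some `f = ∑ c k * y k` is below `r` on the hull and above `r` at the values of `ω`.
  -- The first bound gives `r • 1 - ∑ c k • T k ≥ 0` by scaling and density; applying `ω`
  -- contradicts the second.
  by_contra hmem
  obtain ⟨f, r, hf, hr⟩ := geometric_hahn_banach_closed_point (convex_convexHull ℝ _).closure
    isClosed_closure hmem
  let c : κ → ℝ := fun k => f (Pi.single k 1)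
  have hfc (y : κ → ℝ) : f y = ∑ k, c k * y k := by
    conv_lhs => rw [pi_eq_sum_univ' y]
    simp [c, mul_comm]
  have hunit (x : D) (hx : ‖x‖ = 1) : ∑ k, c k * (⟪T k (j x), j x⟫_ℂ).re ≤ r := by
    rw [← hfc]
    exact (hf _ (subset_closure (subset_convexHull ℝ _ ⟨⟨x, hx⟩, rfl⟩))).le
  have hD (x : D) : ∑ k, c k * (⟪T k (j x), j x⟫_ℂ).re ≤ r * ‖x‖ ^ 2 := by
    rcases eq_or_ne x 0 with rfl | hx
    · simp
    · have hx' : ‖x‖ ≠ 0 := norm_ne_zero_iff.2 hx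
      have h₁ := hunit ((‖x‖⁻¹ : ℂ) • x) (by simp [norm_smul, hx'])
      have h₂ (k : κ) : (⟪T k (j ((‖x‖⁻¹ : ℂ) • x)), j ((‖x‖⁻¹ : ℂ) • x)⟫_ℂ).re =
          (‖x‖ ^ 2)⁻¹ * (⟪T k (j x), j x⟫_ℂ).re := by
        rw [map_smul, map_smul, inner_smul_left, inner_smul_right, ← Complex.ofReal_inv,
          Complex.conj_ofReal, Complex.re_ofReal_mul, Complex.re_ofReal_mul]
        ring
      simp only [h₂, mul_left_comm _ ((‖x‖ ^ 2)⁻¹), ← Finset.mul_sum] at h₁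
      rwa [inv_mul_le_iff₀ (by positivity), mul_comm] at h₁
  have hsum : ∀ x : H, (⟪(r • (1 : H →L[ℂ] H) - ∑ k, c k • T k) x, x⟫_ℂ).re =
      r * ‖x‖ ^ 2 - ∑ k, c k * (⟪T k x, x⟫_ℂ).re := by
    intro x
    simp only [sub_apply, smul_apply, sum_apply, one_apply_eq_self, inner_sub_left, sum_inner,
      Complex.sub_re, Complex.re_sum, ← Complex.coe_smul, inner_smul_left, Complex.conj_ofReal,
      Complex.re_ofReal_mul]
    rw [← inner_self_eq_norm_sq (𝕜 := ℂ)]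
    rfl
  have hpos : 0 ≤ r • (1 : H →L[ℂ] H) - ∑ k, c k • T k := by
    rw [ContinuousLinearMap.nonneg_iff_isPositive, ContinuousLinearMap.isPositive_def']
    refine ⟨?_, fun x => ?_⟩
    · exact ((IsSelfAdjoint.all r).smul (IsSelfAdjoint.one _)).sub
        (isSelfAdjoint_sum _ fun k _ => (IsSelfAdjoint.all (c k)).smul (hT k))
    · rw [ContinuousLinearMap.reApplyInnerSelf_apply]
      refine hj.induction_on (p := fun x => 0 ≤ RCLike.re
        ⟪(r • (1 : H →L[ℂ] H) - ∑ k, c k • T k) x, x⟫_ℂ) x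
        (isClosed_le (by fun_prop) (by fun_prop)) fun x => ?_
      refine (sub_nonneg.2 ?_).trans_eq (hsum (j x)).symm
      rw [j.norm_map]
      exact hD x
  have hω' := ω.map_nonneg hpos
  have : (ω (r • (1 : H →L[ℂ] H) - ∑ k, c k • T k)).re = r - ∑ k, c k * (ω (T k)).re := by
    have hω₁ : ω 1 = 1 := hω
    simp only [map_sub, map_sum, ← Complex.coe_smul, map_smul, hω₁, smul_eq_mul, Complex.sub_re,
      Complex.re_sum, Complex.re_ofReal_mul, Complex.ofReal_re, mul_one]
  rw [hfc] at hr
  have := (Complex.le_def.1 hω').1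
  simp only [Complex.zero_re] at this
  linarith

theorem exists_state_eq_sum_inner {K : Type*} [NormedAddCommGroup K] [InnerProductSpace ℂ K]
    [CompleteSpace K] {ι : Type*} [Fintype ι] {w : ι → ℝ} {x : ι → K} (hw : ∀ i, 0 ≤ w i) (hsum : ∑ i, w i = 1)
    (hx : ∀ i, ‖x i‖ = 1) :
    ∃ ω : (K →L[ℂ] K) →ₚ[ℂ] ℂ, IsState ω ∧ ∀ T, ω T = ∑ i, (w i : ℂ) * ⟪x i, T (x i)⟫_ℂ := by
  let ωₗ : (K →L[ℂ] K) →ₗ[ℂ] ℂ :=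
    { toFun := fun T => ∑ i, (w i : ℂ) * ⟪x i, T (x i)⟫_ℂ
      map_add' := fun S T => by
        simp only [add_apply, inner_add_right, mul_add, Finset.sum_add_distrib]
      map_smul' := fun c T => by
        simp only [smul_apply, inner_smul_right, smul_eq_mul, RingHom.id_apply, mul_left_comm,
          Finset.mul_sum] }
  refine ⟨PositiveLinearMap.mk₀ ωₗ fun T hT => Finset.sum_nonneg fun i _ => ?_, ?_, fun _ => rfl⟩
  · rw [ContinuousLinearMap.nonneg_iff_isPositive] at hT
    exact mul_nonneg (by exact_mod_cast hw i) (hT.inner_nonneg_right _)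
  · change ∑ i, (w i : ℂ) * ⟪x i, x i⟫_ℂ = 1
    simp only [inner_self_eq_norm_sq_to_K, hx]
    simpa using congr_arg ((↑) : ℝ → ℂ) hsum

/-! ### Compressions and tensor products in finite dimension -/

section Tensor

variable {E F : Type*} [NormedAddCommGroup E] [InnerProductSpace ℂ E]
  [NormedAddCommGroup F] [InnerProductSpace ℂ F]

/-- Writing `S = R* R` gives `S ⊗ 1 = (R ⊗ 1)* (R ⊗ 1)`. -/
theorem ContinuousLinearMap.IsPositive.mapL_one [FiniteDimensional ℂ E] [FiniteDimensional ℂ F]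
    {S : E →L[ℂ] E} (hS : S.IsPositive) :
    (TensorProduct.mapL S (1 : F →L[ℂ] F)).IsPositive := by
  have := FiniteDimensional.complete ℂ E
  have := FiniteDimensional.complete ℂ F
  have := FiniteDimensional.complete ℂ (E ⊗[ℂ] F)
  rw [← ContinuousLinearMap.nonneg_iff_isPositive] at hS
  obtain ⟨R, rfl⟩ := CStarAlgebra.nonneg_iff_eq_star_mul_self.1 hS
  rw [← one_mul (1 : F →L[ℂ] F), TensorProduct.mapL_mul]
  convert ContinuousLinearMap.isPositive_adjoint_comp_self (TensorProduct.mapL R (1 : F →L[ℂ] F))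
  rw [TensorProduct.adjoint_mapL]
  rw [← ContinuousLinearMap.star_eq_adjoint (1 : _ →L[ℂ] _), star_one]
  rfl

theorem ContinuousLinearMap.IsPositive.one_mapL [FiniteDimensional ℂ E] [FiniteDimensional ℂ F]
    {T : F →L[ℂ] F} (hT : T.IsPositive) :
    (TensorProduct.mapL (1 : E →L[ℂ] E) T).IsPositive := by
  have := FiniteDimensional.complete ℂ E
  have := FiniteDimensional.complete ℂ F
  have := FiniteDimensional.complete ℂ (E ⊗[ℂ] F)
  rw [← ContinuousLinearMap.nonneg_iff_isPositive] at hT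
  obtain ⟨R, rfl⟩ := CStarAlgebra.nonneg_iff_eq_star_mul_self.1 hT
  rw [← one_mul (1 : E →L[ℂ] E), TensorProduct.mapL_mul]
  convert ContinuousLinearMap.isPositive_adjoint_comp_self (TensorProduct.mapL (1 : E →L[ℂ] E) R)
  rw [TensorProduct.adjoint_mapL]
  rw [← ContinuousLinearMap.star_eq_adjoint (1 : _ →L[ℂ] _), star_one]
  rfl

/-- The compression of a bounded operator along an isometry. -/
noncomputable def compression {G : Type*} [NormedAddCommGroup G] [InnerProductSpace ℂ G]
    [CompleteSpace G] [CompleteSpace E] (u : G →ₗᵢ[ℂ] E) (S : E →L[ℂ] E) : G →L[ℂ] G :=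
  u.toContinuousLinearMap.adjoint ∘L S ∘L u.toContinuousLinearMap

theorem inner_compression_apply {G : Type*} [NormedAddCommGroup G] [InnerProductSpace ℂ G]
    [CompleteSpace G] [CompleteSpace E] (u : G →ₗᵢ[ℂ] E) (S : E →L[ℂ] E) (x y : G) :
    ⟪x, compression u S y⟫_ℂ = ⟪u x, S (u y)⟫_ℂ := by
  rw [compression, ContinuousLinearMap.comp_apply, ContinuousLinearMap.adjoint_inner_right]
  rfl

theorem inner_map_compression {G G' : Type*} [NormedAddCommGroup G] [InnerProductSpace ℂ G]
    [CompleteSpace G] [CompleteSpace E] [NormedAddCommGroup G'] [InnerProductSpace ℂ G']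
    [CompleteSpace G'] [CompleteSpace F] (u : G →ₗᵢ[ℂ] E) (v : G' →ₗᵢ[ℂ] F)
    (S : E →L[ℂ] E) (T : F →L[ℂ] F) (x y : G ⊗[ℂ] G') :
    ⟪x, TensorProduct.mapL (compression u S) (compression v T) y⟫_ℂ =
      ⟪TensorProduct.map u.toLinearMap v.toLinearMap x,
        TensorProduct.mapL S T (TensorProduct.map u.toLinearMap v.toLinearMap y)⟫_ℂ := by
  induction x with
  | zero => rw [map_zero, inner_zero_left, inner_zero_left]
  | add x₁ x₂ h₁ h₂ => rw [map_add, inner_add_left, inner_add_left, h₁, h₂]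
  | tmul a b =>
    induction y with
    | zero => rw [map_zero, map_zero, map_zero, inner_zero_right, inner_zero_right]
    | add y₁ y₂ h₁ h₂ => rw [map_add, map_add, map_add, inner_add_right, inner_add_right, h₁, h₂]
    | tmul c d =>
      simp only [TensorProduct.mapL_tmul, TensorProduct.map_tmul, TensorProduct.inner_tmul,
        inner_compression_apply, LinearIsometry.coe_toLinearMap]

/-- Normalization survives because `u* u = 1` for an isometry. -/
theorem IsPOVMFamily.compression {I : Type*} {A : I → Type*} [∀ i, Fintype (A i)]
    {G : Type*} [NormedAddCommGroup G] [InnerProductSpace ℂ G] [CompleteSpace G] [CompleteSpace E]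
    {X : ∀ i, A i → (E →L[ℂ] E)} (hX : IsPOVMFamily X) (u : G →ₗᵢ[ℂ] E) :
    IsPOVMFamily fun i α => _root_.compression u (X i α) where
  isPositive i α := (hX.isPositive i α).adjoint_conj _
  sum_eq_one i := by
    refine ContinuousLinearMap.ext fun y => ext_inner_left ℂ fun x => ?_
    simp only [sum_apply, inner_sum, inner_compression_apply]
    rw [← inner_sum, ← sum_apply, hX.sum_eq_one]
    exact u.inner_map_map x y

/-- Finitely many elements of a tensor product lie in the tensor product of finite-dimensional
subspaces. -/
theorem TensorProduct.exists_finiteDimensional_isometry {E F : Type w} [NormedAddCommGroup E]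
    [InnerProductSpace ℂ E] [NormedAddCommGroup F] [InnerProductSpace ℂ F] {ι : Type*} [Finite ι]
    (x : ι → E ⊗[ℂ] F) :
    ∃ (G : Type w) (_ : NormedAddCommGroup G) (_ : InnerProductSpace ℂ G)
      (_ : FiniteDimensional ℂ G) (G' : Type w) (_ : NormedAddCommGroup G')
      (_ : InnerProductSpace ℂ G') (_ : FiniteDimensional ℂ G') (u : G →ₗᵢ[ℂ] E)
      (v : G' →ₗᵢ[ℂ] F) (y : ι → G ⊗[ℂ] G'),
      ∀ i, TensorProduct.map u.toLinearMap v.toLinearMap (y i) = x i := by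
  obtain ⟨V, W, hV, hW, hVW⟩ := TensorProduct.exists_finite_submodule_of_setFinite
    (Set.range x) (Set.finite_range x)
  choose y hy using fun i => hVW ⟨i, rfl⟩
  exact ⟨V, inferInstance, inferInstance, hV, W, inferInstance, inferInstance, hW,
    V.subtypeₗᵢ, W.subtypeₗᵢ, y, hy⟩

theorem IsPOVMFamily.mapL_one {I : Type*} {A : I → Type*} [∀ i, Fintype (A i)]
    [FiniteDimensional ℂ E] [FiniteDimensional ℂ F]
    {X : ∀ i, A i → (E →L[ℂ] E)} (hX : IsPOVMFamily X) :
    IsPOVMFamily fun i α => TensorProduct.mapL (X i α) (1 : F →L[ℂ] F) where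
  isPositive i α := (hX.isPositive i α).mapL_one
  sum_eq_one i := by
    have h := map_sum (AddMonoidHom.mk' (fun S : E →L[ℂ] E => TensorProduct.mapL S (1 : F →L[ℂ] F))
      fun S S' => TensorProduct.mapL_add_left S S' 1) (X i) Finset.univ
    rw [hX.sum_eq_one] at h
    exact h.symm.trans TensorProduct.mapL_id_id

theorem IsPOVMFamily.one_mapL {I : Type*} {A : I → Type*} [∀ i, Fintype (A i)]
    [FiniteDimensional ℂ E] [FiniteDimensional ℂ F]
    {Y : ∀ i, A i → (F →L[ℂ] F)} (hY : IsPOVMFamily Y) :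
    IsPOVMFamily fun i α => TensorProduct.mapL (1 : E →L[ℂ] E) (Y i α) where
  isPositive i α := (hY.isPositive i α).one_mapL
  sum_eq_one i := by
    have h := map_sum (AddMonoidHom.mk' (fun T : F →L[ℂ] F => TensorProduct.mapL (1 : E →L[ℂ] E) T)
      fun T T' => TensorProduct.mapL_add_right 1 T T') (Y i) Finset.univ
    rw [hY.sum_eq_one] at h
    exact h.symm.trans TensorProduct.mapL_id_id

end Tensor

/-! ### From a tensor model to approximations -/

theorem IsTensorRealizable.isApproxFiniteDimensional {I : Type uI} {J : Type uJ} [Finite I]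
    [Finite J] {A : I → Type uA} {B : J → Type uB} [∀ i, Fintype (A i)] [∀ j, Fintype (B j)]
    {p : ∀ i j, A i → B j → ℝ} (h : IsTensorRealizable.{uI, uJ, uA, uB, w} p) :
    IsApproxFiniteDimensional.{uI, uJ, uA, uB, w} p := by
  classical
  have := Fintype.ofFinite I
  have := Fintype.ofFinite J
  obtain ⟨HA, _, _, _, HB, _, _, _, X, Y, ω, hX, hY, hω, hp⟩ := h
  intro ε hε
  have hmem := hω.mem_closure_convexHull
    (j := (UniformSpace.Completion.toComplₗᵢ : (HA ⊗[ℂ] HB) →ₗᵢ[ℂ] HilbertTensor HA HB))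
    UniformSpace.Completion.denseRange_coe
    (T := fun k : (Σ i, A i) × (Σ j, B j) => opTensor (X k.1.1 k.1.2) (Y k.2.1 k.2.2))
    fun k => isSelfAdjoint_opTensor (hX.isPositive _ _).isSymmetric (hY.isPositive _ _).isSymmetric
  obtain ⟨y, hy, hdist⟩ := Metric.mem_closure_iff.1 hmem ε hε
  obtain ⟨ι, _, c, z, hc, hc₁, hz, rfl⟩ := mem_convexHull_iff_exists_fintype.1 hy
  choose x hx using hz
  obtain ⟨G, _, _, _, G', _, _, _, u, v, ψ, hψ⟩ :=
    TensorProduct.exists_finiteDimensional_isometry fun i => (x i : HA ⊗[ℂ] HB)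
  have hψ₁ (i : ι) : ‖ψ i‖ = 1 := by rw [← TensorProduct.norm_map u v, hψ, (x i).2]
  have := FiniteDimensional.complete ℂ G
  have := FiniteDimensional.complete ℂ G'
  have := FiniteDimensional.complete ℂ (G ⊗[ℂ] G')
  obtain ⟨φ, hφ, hφc⟩ := exists_state_eq_sum_inner hc hc₁ hψ₁
  refine ⟨G ⊗[ℂ] G', inferInstance, inferInstance, inferInstance, _, _, φ,
    (hX.compression u).mapL_one, (hY.compression v).one_mapL, fun i j α β => ?_, hφ,
    fun i j α β => ?_⟩
  · rw [commute_iff_eq, ← TensorProduct.mapL_mul, ← TensorProduct.mapL_mul]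
    simp
  · have hre := congr_arg Complex.re (hp i j α β)
    -- Compression costs no accuracy: `φ` reproduces the chosen point of the convex hull exactly, so
    -- the only error is its distance to the values of `ω`.
    have hφp : φ (TensorProduct.mapL (compression u (X i α)) 1 *
        TensorProduct.mapL 1 (compression v (Y j β))) =
        ((∑ i, c i • z i) (⟨i, α⟩, ⟨j, β⟩) : ℝ) := by
      rw [hφc, ← TensorProduct.mapL_mul, mul_one, one_mul, Finset.sum_apply, Complex.ofReal_sum]
      refine Finset.sum_congr rfl fun l _ => ?_
      rw [inner_map_compression, hψ, Pi.smul_apply, ← hx l, smul_eq_mul, Complex.ofReal_mul]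
      congr 1
      -- The hull records real parts only; symmetry shows that these expectations are already real.
      have hsymm := TensorProduct.isSymmetric_map (hX.isPositive i α).isSymmetric
        (hY.isPositive j β).isSymmetric
      simp only [UniformSpace.Completion.coe_toComplₗᵢ, opTensor_coe,
        UniformSpace.Completion.inner_coe, TensorProduct.mapL_apply]
      rw [← hsymm]
      exact (hsymm.coe_re_inner_apply_self _).symm
    have hd := (dist_le_pi_dist _ _ (⟨i, α⟩, ⟨j, β⟩)).trans_lt hdist
    rw [hφp, ← Complex.ofReal_sub, Complex.norm_real]
    rw [Complex.ofReal_re] at hre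
    rwa [hre]

theorem theorem2 {I : Type uI} {J : Type uJ} [Finite I] [Finite J]
    {A : I → Type uA} {B : J → Type uB} [∀ i, Fintype (A i)] [∀ j, Fintype (B j)]
    {H : Type uH} [NormedAddCommGroup H] [InnerProductSpace ℂ H] [CompleteSpace H]
    (X : ∀ i, A i → (H →L[ℂ] H)) (Y : ∀ j, B j → (H →L[ℂ] H)) (ω : (H →L[ℂ] H) →ₚ[ℂ] ℂ)
    (hX : ∀ i α, (X i α).IsPositive) (hY : ∀ j β, (Y j β).IsPositive)
    (hXY : ∀ i j α β, Commute (X i α) (Y j β)) (hω : IsState ω)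
    (p : ∀ i j, A i → B j → ℝ) (hp : ∀ i j α β, (p i j α β : ℂ) = ω (X i α * Y j β)) :
    IsApproxFiniteDimensional.{uI, uJ, uA, uB, v} p ↔
      IsTensorRealizable.{uI, uJ, uA, uB, w} p := by
  exact ⟨fun h => h.isTensorRealizable, fun h => h.isApproxFiniteDimensional.lift⟩
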